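/- Let $(W,S)$ be a finite Coxeter system of rank $n$ with $S=\{s_1,\dots,s_n\}$ and length function $\ell$. For $w\in W$ let $d(w)=\#\{j : \ell(s_jw)<\ell(w)\}$ be the number of left descents. For $I\subseteq\{1,\dots,n\}$ let $W_I$ be the subgroup generated by $\{s_i : i\in I\}$ and $w_0(W_I)$ its element of maximal length, and for $0\le x\le n$ put $\mathrm{maxw}_0(W,x)=\max\{\ell(w_0(W_I)) : |I|=x\}$. Call $w\in W$ proper if $\ell(w)\le n+\mathrm{maxw}_0(W,d(w))$. Proposition 5.6. The number of proper elements in the Coxeter group of type $D_n$ is at most $2^n\,n!\cdot e^{-\Omega(n)}$; that is, there are an absolute constant $c>0$ and an $N$ such that for all $n\ge N$ the Coxeter group of type $D_n$ has at most $2^n\,n!\,e^{-cn}$ proper elements. -/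

import Mathlib

/-- The Coxeter matrix of type `D_n`, with nodes `0, 1, …, n - 1` and diagram
```
    0
     \
      2 --- 3 --- ⬝ ⬝ ⬝ --- (n - 1)
     /
    1
```
(all edges have label `3`).  Mathlib's `CoxeterMatrix.D` is not used: in it the nodes
`n - 3`, `n - 2`, `n - 1` are pairwise joined, so its diagram contains a triangle. -/
def coxeterMatrixTypeD (n : ℕ) : CoxeterMatrix (Fin n) where
  M := Matrix.of fun i j : Fin n ↦
    if i = j then 1
    else if (1 ≤ (i : ℕ) ∧ (i : ℕ) + 1 = j) ∨ (1 ≤ (j : ℕ) ∧ (j : ℕ) + 1 = i) ∨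
      ((i : ℕ) = 0 ∧ (j : ℕ) = 2) ∨ ((j : ℕ) = 0 ∧ (i : ℕ) = 2) then 3
    else 2
  isSymm := by
    ext i j
    simp only [Matrix.transpose_apply, Matrix.of_apply]
    grind
  diagonal := by simp
  off_diagonal := by
    intro i j h
    simp only [Matrix.of_apply]
    grind

namespace CoxeterSystem

/-- The parabolic subgroup `W_I`, generated by the simple reflections `s_i` with `i ∈ I`. -/
def parabolic {B W : Type*} [Group W] {M : CoxeterMatrix B} (cs : CoxeterSystem M W)
    (I : Finset B) : Subgroup W :=
  Subgroup.closure (cs.simple '' (I : Set B))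

/-- `ℓ(w₀(W_I))`: the maximal length of an element of the parabolic subgroup `W_I`
(for `W` finite, where the set of lengths is finite, so that the supremum is attained). -/
noncomputable def longestLength {B W : Type*} [Group W] {M : CoxeterMatrix B}
    (cs : CoxeterSystem M W) (I : Finset B) : ℕ :=
  sSup (cs.length '' (cs.parabolic I : Set W))

/-- `maxw₀(W, x)`: the maximum of `ℓ(w₀(W_I))` over all sets `I` of `x` nodes. -/
noncomputable def maxw₀ {B W : Type*} [Fintype B] [Group W] {M : CoxeterMatrix B}
    (cs : CoxeterSystem M W) (x : ℕ) : ℕ :=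
  (Finset.powersetCard x (Finset.univ : Finset B)).sup cs.longestLength

/-- `d(w)`: the number of left descents of `w`, i.e. of `j` with `ℓ(s_j w) < ℓ(w)`. -/
noncomputable def leftDescentCount {B W : Type*} [Group W] {M : CoxeterMatrix B}
    (cs : CoxeterSystem M W) (w : W) : ℕ :=
  {j : B | cs.IsLeftDescent w j}.ncard

/-- `w` is proper if `ℓ(w) ≤ n + maxw₀(W, d(w))`, where `n` is the rank. -/
def IsProper {B W : Type*} [Fintype B] [Group W] {M : CoxeterMatrix B}
    (cs : CoxeterSystem M W) (w : W) : Prop :=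
  cs.length w ≤ Fintype.card B + cs.maxw₀ (cs.leftDescentCount w)

end CoxeterSystem

namespace TypeD

/-! The group acts on ℤⁿ by signed permutations, and `w` is determined by `w • rho`, where `rho =
(0, 1, …, n - 1)`. This image is a vector with absolute values `π` and signs `ε`; its length and
left descents can be read off as the positive and simple roots that are negative on it
(`length_eq_inversions`, `isLeftDescent_iff_coroot_neg`).

Fix `π` and let the signs vary. For two coordinates, the sign of their sum or difference is decided
by the one of larger absolute value. Hence length and descent count are, up to the single node `0`,
affine in `ε`, with means near n²/2 and n/2 (`inversions_signedVec`, `sum_sign_mul_descentCoeff`). A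
parabolic subgroup of rank `x` has longest length at most x² + O(x) (`maxw₀_le`), about n²/4 at the
typical descent count and so well below n²/2. A proper element therefore needs one of two sign sums
to deviate on the scale of its maximum, which by a Chernoff bound happens for at most 2ⁿe^{-cn} sign
vectors. Summing over the n! choices of `π` gives the result. -/

/-- The vector whose absolute values and signs are prescribed by `π` and `ε`. -/
def signedVec {n : ℕ} (π : Equiv.Perm (Fin n)) (ε : Fin n → ℤˣ) : Fin n → ℤ :=
  fun k ↦ ε k * (π k : ℕ)

/-- Chernoff bound for independent uniform signs: the exponential moment factors into hyperbolic
cosines, and cosh x ≤ exp(x²/2). -/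
lemma card_sum_ge_le {n : ℕ} (b : Fin n → ℝ) (t T : ℝ) (ht : 0 ≤ t) :
    ((Finset.univ.filter fun ε : Fin n → ℤˣ ↦ T ≤ ∑ k, ((ε k : ℤ) : ℝ) * b k).card : ℝ) ≤
      2 ^ n * Real.exp (-(t * T) + t ^ 2 / 2 * ∑ k, b k ^ 2) := by
  have h1 : ∑ ε : Fin n → ℤˣ, Real.exp (t * ∑ k, ((ε k : ℤ) : ℝ) * b k) =
      ∏ k, (2 * Real.cosh (t * b k)) := by
    have h := Finset.prod_univ_sum (fun _ : Fin n ↦ (Finset.univ : Finset ℤˣ))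
      (fun k (e : ℤˣ) ↦ Real.exp (t * (((e : ℤ) : ℝ) * b k)))
    rw [Fintype.piFinset_univ] at h
    simp_rw [Finset.mul_sum, Real.exp_sum, ← h]
    refine Finset.prod_congr rfl fun k _ ↦ ?_
    rw [UnitsInt.univ, Finset.sum_pair (by decide), Real.cosh_eq]
    simp
    ring
  have h2 : ∏ k, (2 * Real.cosh (t * b k)) ≤ 2 ^ n * Real.exp (t ^ 2 / 2 * ∑ k, b k ^ 2) := by
    rw [Finset.prod_mul_distrib, Finset.prod_const, Finset.card_univ, Fintype.card_fin,
      Finset.mul_sum, Real.exp_sum]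
    refine mul_le_mul_of_nonneg_left (Finset.prod_le_prod (fun k _ ↦ (Real.cosh_pos _).le)
      fun k _ ↦ ?_) (by positivity)
    refine (Real.cosh_le_exp_half_sq _).trans (Real.exp_le_exp.2 (le_of_eq (by ring)))
  calc ((Finset.univ.filter fun ε : Fin n → ℤˣ ↦ T ≤ ∑ k, ((ε k : ℤ) : ℝ) * b k).card : ℝ)
      = ∑ ε : Fin n → ℤˣ with T ≤ ∑ k, ((ε k : ℤ) : ℝ) * b k, (1 : ℝ) := by simp
    _ ≤ ∑ ε : Fin n → ℤˣ with T ≤ ∑ k, ((ε k : ℤ) : ℝ) * b k,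
          Real.exp (-(t * T)) * Real.exp (t * ∑ k, ((ε k : ℤ) : ℝ) * b k) := by
        refine Finset.sum_le_sum fun ε hε ↦ ?_
        rw [Finset.mem_filter] at hε
        rw [← Real.exp_add, Real.one_le_exp_iff]
        have := mul_le_mul_of_nonneg_left hε.2 ht
        linarith
    _ ≤ ∑ ε : Fin n → ℤˣ,
          Real.exp (-(t * T)) * Real.exp (t * ∑ k, ((ε k : ℤ) : ℝ) * b k) :=
        Finset.sum_le_sum_of_subset_of_nonneg (Finset.filter_subset _ _)
          fun _ _ _ ↦ by positivity
    _ ≤ Real.exp (-(t * T)) * (2 ^ n * Real.exp (t ^ 2 / 2 * ∑ k, b k ^ 2)) := by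
        rw [← Finset.mul_sum, h1]
        exact mul_le_mul_of_nonneg_left h2 (by positivity)
    _ = _ := by rw [Real.exp_add]; ring

/-! ### Descents of signed permutations as sign sums -/

/-- The number of positions before `j` at which `π` takes a smaller value. -/
def smallerBefore {n : ℕ} (π : Equiv.Perm (Fin n)) (j : Fin n) : ℕ :=
  ((Finset.Iio j).filter fun i ↦ π i < π j).card

lemma smallerBefore_le {n : ℕ} (π : Equiv.Perm (Fin n)) (j : Fin n) : smallerBefore π j ≤ n :=
  (Finset.card_le_univ _).trans (Fintype.card_fin n).le

/-- The coefficients of the signs in the signed count of the descents of `signedVec π ε`. -/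
def descentCoeff {m : ℕ} (π : Equiv.Perm (Fin (m + 2))) (k : Fin (m + 2)) : ℤ :=
  (Fin.snoc (fun j : Fin (m + 1) ↦ if π j.succ < π j.castSucc then (1 : ℤ) else 0) 0 :
      Fin (m + 2) → ℤ) k -
    (Fin.cons 0 (fun j : Fin (m + 1) ↦ if π j.castSucc < π j.succ then (1 : ℤ) else 0) :
      Fin (m + 2) → ℤ) k

lemma descentCoeff_sq_le {m : ℕ} (π : Equiv.Perm (Fin (m + 2))) (k : Fin (m + 2)) :
    descentCoeff π k ^ 2 ≤ 1 := by
  have h1 : ∀ k, (Fin.snoc (fun j : Fin (m + 1) ↦ if π j.succ < π j.castSucc then (1 : ℤ) else 0) 0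
      : Fin (m + 2) → ℤ) k ∈ Set.Icc (0 : ℤ) 1 := by
    intro k
    induction k using Fin.lastCases with
    | last => simp
    | cast j => rw [Fin.snoc_castSucc]; split_ifs <;> simp
  have h2 : ∀ k, (Fin.cons 0 (fun j : Fin (m + 1) ↦ if π j.castSucc < π j.succ then (1 : ℤ) else 0)
      : Fin (m + 2) → ℤ) k ∈ Set.Icc (0 : ℤ) 1 := by
    intro k
    induction k using Fin.cases with
    | zero => simp
    | succ j => rw [Fin.cons_succ]; split_ifs <;> simp
  obtain ⟨a1, a2⟩ := h1 k
  obtain ⟨b1, b2⟩ := h2 k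
  rw [sq_le_one_iff_abs_le_one, abs_le, descentCoeff]
  constructor <;> linarith

/-- Of two neighbouring entries the one of larger absolute value decides: if it is the left one
there is a descent exactly when its sign is `+`, if it is the right one exactly when its sign is
`-`. -/
lemma sum_sign_mul_descentCoeff {m : ℕ} (π : Equiv.Perm (Fin (m + 2))) (ε : Fin (m + 2) → ℤˣ) :
    ∑ k, (ε k : ℤ) * descentCoeff π k =
      2 * ((Finset.univ.filter fun j : Fin (m + 1) ↦
        signedVec π ε j.succ < signedVec π ε j.castSucc).card : ℤ) - (m + 1) := by
  simp only [descentCoeff, mul_sub, Finset.sum_sub_distrib]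
  rw [Fin.sum_univ_castSucc, Fin.sum_univ_succ (n := m + 1)]
  simp only [Fin.snoc_castSucc, Fin.snoc_last, Fin.cons_succ, Fin.cons_zero, mul_zero, add_zero,
    zero_add]
  rw [← Finset.sum_sub_distrib, Finset.card_filter]
  push_cast
  have : ((m : ℤ) + 1) = ∑ _j : Fin (m + 1), 1 := by simp
  rw [this, Finset.mul_sum, ← Finset.sum_sub_distrib]
  refine Finset.sum_congr rfl fun j _ ↦ ?_
  have hne : (π j.castSucc : ℕ) ≠ π j.succ := fun h ↦ by
    have := π.injective (Fin.ext h)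
    simp [Fin.ext_iff] at this
  have e1 : signedVec π ε j.succ = ε j.succ * (π j.succ : ℕ) := rfl
  have e2 : signedVec π ε j.castSucc = ε j.castSucc * (π j.castSucc : ℕ) := rfl
  rw [e1, e2]
  simp only [Fin.lt_def]
  rcases Int.units_eq_one_or (ε j.castSucc) with h | h <;>
  rcases Int.units_eq_one_or (ε j.succ) with h' | h' <;>
  simp only [h, h', Units.val_neg, Units.val_one] <;> grind

end TypeD

namespace TypeD

variable {m : ℕ}

/-! ### Simple roots and reflections of type D -/

/-- The coordinate that the node `i` exchanges with the coordinate `i`. -/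
def prev (i : Fin (m + 2)) : Fin (m + 2) :=
  if i = 0 then 1 else ⟨i - 1, by omega⟩

/-- The sign with which the node `i` exchanges two coordinates. -/
def nodeSign (i : Fin (m + 2)) : ℤ := if i = 0 then -1 else 1

/-- The simple root of the node `i`. -/
def root (i : Fin (m + 2)) : Fin (m + 2) → ℤ :=
  fun k ↦ if k = i then 1 else if k = prev i then -nodeSign i else 0

/-- The simple coroot of the node `i`. -/
def coroot (i : Fin (m + 2)) : (Fin (m + 2) → ℤ) →ₗ[ℤ] ℤ :=
  LinearMap.proj i - nodeSign i • LinearMap.proj (prev i)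

/-- The simple reflection of the node `i`. -/
def refl (i : Fin (m + 2)) : Module.End ℤ (Fin (m + 2) → ℤ) :=
  LinearMap.id - (coroot i).smulRight (root i)

lemma coroot_apply (i : Fin (m + 2)) (v : Fin (m + 2) → ℤ) :
    coroot i v = v i - nodeSign i * v (prev i) := by
  simp [coroot]

lemma refl_apply (i : Fin (m + 2)) (v : Fin (m + 2) → ℤ) :
    refl i v = v - coroot i v • root i := by
  simp [refl]

lemma prev_val (i : Fin (m + 2)) : (prev i : ℕ) = if (i : ℕ) = 0 then 1 else (i : ℕ) - 1 := by
  unfold prev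
  by_cases h : i = 0
  · simp [h]
  · have : (i : ℕ) ≠ 0 := fun h' ↦ h (Fin.ext h')
    simp [h, this]

lemma prev_ne (i : Fin (m + 2)) : prev i ≠ i := by
  intro h
  have := congrArg Fin.val h
  rw [prev_val] at this
  grind

lemma nodeSign_mul_self (i : Fin (m + 2)) : nodeSign i * nodeSign i = 1 := by
  unfold nodeSign; split_ifs <;> rfl

lemma refl_apply_coord (i k : Fin (m + 2)) (v : Fin (m + 2) → ℤ) :
    refl i v k = if k = i then nodeSign i * v (prev i)
      else if k = prev i then nodeSign i * v i else v k := by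
  have := nodeSign_mul_self i
  rw [refl_apply, coroot_apply]
  simp only [Pi.sub_apply, Pi.smul_apply, root, smul_eq_mul]
  split_ifs with h1 h2
  · subst h1; ring
  · subst h2; linear_combination (-v (prev i)) * this
  · ring

lemma coroot_root_self (i : Fin (m + 2)) : coroot i (root i) = 2 := by
  have := nodeSign_mul_self i
  rw [coroot_apply]
  simp only [root, prev_ne, if_true, if_false]
  linear_combination this

lemma coroot_root_of_eq_two {i j : Fin (m + 2)} (h : coxeterMatrixTypeD (m + 2) i j = 2) :
    coroot i (root j) = 0 := by
  rw [coroot_apply]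
  have hi := prev_val i
  have hj := prev_val j
  change (if i = j then 1 else if _ then 3 else 2) = 2 at h
  simp only [root, nodeSign, Fin.ext_iff, Fin.val_zero] at h hi hj ⊢
  grind

lemma coroot_root_of_eq_three {i j : Fin (m + 2)} (h : coxeterMatrixTypeD (m + 2) i j = 3) :
    coroot i (root j) = -1 := by
  rw [coroot_apply]
  have hi := prev_val i
  have hj := prev_val j
  change (if i = j then 1 else if _ then 3 else 2) = 3 at h
  simp only [root, nodeSign, Fin.ext_iff, Fin.val_zero] at h hi hj ⊢
  grind

lemma coxeterMatrix_cases {i j : Fin (m + 2)} (h : i ≠ j) :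
    coxeterMatrixTypeD (m + 2) i j = 2 ∨ coxeterMatrixTypeD (m + 2) i j = 3 := by
  change (if i = j then 1 else if _ then 3 else 2) = 2 ∨
    (if i = j then 1 else if _ then 3 else 2) = 3
  grind

lemma coroot_refl (i j : Fin (m + 2)) (v : Fin (m + 2) → ℤ) :
    coroot i (refl j v) = coroot i v - coroot j v * coroot i (root j) := by
  rw [refl_apply, map_sub, map_smul, smul_eq_mul]

lemma refl_refl (i : Fin (m + 2)) (v : Fin (m + 2) → ℤ) : refl i (refl i v) = v := by
  rw [refl_apply i (refl i v), coroot_refl, coroot_root_self, refl_apply]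
  module

/-- The Coxeter relations follow formally from the Cartan integers 2, 0 and -1. -/
lemma isLiftable_refl : (coxeterMatrixTypeD (m + 2)).IsLiftable (refl (m := m)) := by
  intro i j
  by_cases hij : i = j
  · subst hij
    rw [(coxeterMatrixTypeD (m + 2)).diagonal, pow_one]
    exact LinearMap.ext fun v ↦ refl_refl i v
  rcases coxeterMatrix_cases hij with h | h
  · have h1 := coroot_root_of_eq_two h
    have h2 := coroot_root_of_eq_two ((coxeterMatrixTypeD (m + 2)).symmetric i j ▸ h)
    rw [h]
    refine LinearMap.ext fun v ↦ ?_
    simp only [pow_succ, pow_zero, one_mul, Module.End.mul_apply, Module.End.one_apply,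
      refl_apply, map_sub, map_smul, coroot_root_self, h1, h2]
    module
  · have h1 := coroot_root_of_eq_three h
    have h2 := coroot_root_of_eq_three ((coxeterMatrixTypeD (m + 2)).symmetric i j ▸ h)
    rw [h]
    refine LinearMap.ext fun v ↦ ?_
    simp only [pow_succ, pow_zero, one_mul, Module.End.mul_apply, Module.End.one_apply,
      refl_apply, map_sub, map_smul, coroot_root_self, h1, h2]
    module

/-- The vector `(0, 1, …, n - 1)`, half the sum of the positive roots. -/
def rho : Fin (m + 2) → ℤ := fun k ↦ (k : ℕ)

lemma coroot_rho_pos (i : Fin (m + 2)) : 0 < coroot i rho := by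
  rw [coroot_apply]
  have := prev_val i
  simp only [rho, nodeSign, Fin.ext_iff, Fin.val_zero] at this ⊢
  grind

/-! ### The reflection representation and descents -/

section Action

variable {W : Type*} [Group W] (cs : CoxeterSystem (coxeterMatrixTypeD (m + 2)) W)

/-- The reflection representation of the Coxeter group of type `D`. -/
def rep : W →* Module.End ℤ (Fin (m + 2) → ℤ) := cs.lift ⟨refl, isLiftable_refl⟩

lemma rep_simple_mul (i : Fin (m + 2)) (w : W) (v : Fin (m + 2) → ℤ) :
    rep cs (cs.simple i * w) v = refl i (rep cs w v) := by
  rw [map_mul, rep, cs.lift_apply_simple]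
  rfl

lemma simple_comm_of_eq_two {i j : Fin (m + 2)} (h : coxeterMatrixTypeD (m + 2) i j = 2) :
    cs.simple i * cs.simple j = cs.simple j * cs.simple i := by
  have := cs.simple_mul_simple_pow i j
  rw [h, pow_two] at this
  rw [eq_inv_of_mul_eq_one_left this, mul_inv_rev, cs.inv_simple, cs.inv_simple]

lemma simple_braid_of_eq_three {i j : Fin (m + 2)} (h : coxeterMatrixTypeD (m + 2) i j = 3) :
    cs.simple i * (cs.simple j * cs.simple i) = cs.simple j * (cs.simple i * cs.simple j) := by
  have := cs.simple_mul_simple_pow i j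
  rw [h, pow_succ, pow_two] at this
  have h2 : cs.simple i * (cs.simple j * cs.simple i) *
      (cs.simple j * (cs.simple i * cs.simple j)) = 1 := by
    simpa only [mul_assoc] using this
  rw [eq_inv_of_mul_eq_one_left h2]
  simp only [mul_inv_rev, cs.inv_simple, mul_assoc]

/-- Induction on length inside the rank-two subgroup of `i` and a descent `j` of `w`: stripping one
or two letters expresses the value as a value, or a sum of two values, of simple coroots at a
shorter element where they are not descents. -/
theorem coroot_rep_rho_pos (w : W) (i : Fin (m + 2)) (hi : ¬ cs.IsLeftDescent w i) :
    0 < coroot i (rep cs w rho) := by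
  induction hk : cs.length w using Nat.strong_induction_on generalizing w i with
  | _ k ih =>
  subst hk
  by_cases hw : w = 1
  · subst hw; simpa using coroot_rho_pos i
  obtain ⟨j, hj⟩ := cs.exists_leftDescent_of_ne_one hw
  have hij : i ≠ j := by rintro rfl; exact hi hj
  rw [cs.not_isLeftDescent_iff] at hi
  have hj' := cs.isLeftDescent_iff.1 hj
  have hx : w = cs.simple j * (cs.simple j * w) := by simp
  set x := cs.simple j * w with hxdef
  have hxj : ¬ cs.IsLeftDescent x j := by
    rw [CoxeterSystem.IsLeftDescent, ← hx]; omega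
  have hlen : cs.length x < cs.length w := by omega
  have key : ¬ cs.IsLeftDescent x i → 0 < coroot i (rep cs x rho) := fun h ↦ ih _ hlen x i h rfl
  have keyj := ih _ hlen x j hxj rfl
  rcases coxeterMatrix_cases hij with h | h
  · rw [hx, rep_simple_mul, coroot_refl, coroot_root_of_eq_two h]
    have : ¬ cs.IsLeftDescent x i := by
      intro hd
      have e : cs.simple i * x = cs.simple j * (cs.simple i * w) := by
        rw [hxdef, ← mul_assoc, simple_comm_of_eq_two cs h, mul_assoc]
      rw [cs.isLeftDescent_iff, e] at hd
      have := cs.length_simple_mul (cs.simple i * w) j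
      omega
    have := key this
    omega
  · by_cases hd : cs.IsLeftDescent x i
    · rw [cs.isLeftDescent_iff] at hd
      have hy : x = cs.simple i * (cs.simple i * x) := by simp
      set y := cs.simple i * x with hydef
      -- Otherwise, by the braid relation, `s_i s_j s_i w` would have length `ℓ(w) - 3`, although
      -- `ℓ(s_i w) = ℓ(w) + 1`.
      have hyj : ¬ cs.IsLeftDescent y j := by
        intro hd'
        rw [cs.isLeftDescent_iff] at hd'
        have e : cs.simple j * y = cs.simple i * (cs.simple j * (cs.simple i * w)) := by
          rw [hydef, hxdef]
          simpa only [mul_assoc] using congrArg (· * w) (simple_braid_of_eq_three cs h).symm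
        rw [e] at hd'
        have h1 := cs.length_simple_mul (cs.simple j * (cs.simple i * w)) i
        have h2 := cs.length_simple_mul (cs.simple i * w) j
        omega
      have := ih _ (by omega) y j hyj rfl
      rw [hx, rep_simple_mul, hy, rep_simple_mul, coroot_refl, coroot_refl, coroot_refl,
        coroot_root_self, coroot_root_of_eq_three h,
        coroot_root_of_eq_three ((coxeterMatrixTypeD (m + 2)).symmetric i j ▸ h)]
      linarith
    · have := key hd
      rw [hx, rep_simple_mul, coroot_refl, coroot_root_of_eq_three h]
      linarith

theorem isLeftDescent_iff_coroot_neg (w : W) (i : Fin (m + 2)) :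
    cs.IsLeftDescent w i ↔ coroot i (rep cs w rho) < 0 := by
  refine ⟨fun h ↦ ?_, fun h ↦ ?_⟩
  · have := coroot_rep_rho_pos cs _ i (cs.isLeftDescent_iff_not_isLeftDescent_mul.1 h)
    rw [rep_simple_mul, coroot_refl, coroot_root_self] at this
    linarith
  · by_contra h'
    exact absurd (coroot_rep_rho_pos cs w i h') (by omega)

/-- A nontrivial element has a descent, so some simple coroot is negative on its image of `rho`; it
cannot fix `rho`. -/
theorem rep_rho_injective : Function.Injective fun w : W ↦ rep cs w rho := by
  intro w w' h
  rw [← inv_mul_eq_one]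
  by_contra hne
  obtain ⟨i, hi⟩ := cs.exists_leftDescent_of_ne_one hne
  rw [isLeftDescent_iff_coroot_neg, map_mul, Module.End.mul_apply] at hi
  have h' : rep cs w' rho = rep cs w rho := h.symm
  rw [h', ← Module.End.mul_apply, ← map_mul, inv_mul_cancel, map_one] at hi
  exact absurd (coroot_rho_pos i) (by simpa using hi.le)

end Action

/-! ### Length as a count of inversions -/

/-- The number of positive roots of type `D` that are negative on `v`. -/
def inversions {n : ℕ} (v : Fin n → ℤ) : ℕ :=
  ∑ x : Fin n × Fin n with x.1 < x.2,
    ((if v x.2 < v x.1 then 1 else 0) + if v x.1 + v x.2 < 0 then 1 else 0)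

/-- A simple reflection permutes the positive roots other than its own. -/
lemma inversions_refl_of_ne_zero {i : Fin (m + 2)} (hi : i ≠ 0) {v : Fin (m + 2) → ℤ}
    (h : coroot i v < 0) : inversions (refl i v) + 1 = inversions v := by
  have hr : ∀ k, refl i v k = v (Equiv.swap i (prev i) k) := fun k ↦ by
    rw [refl_apply_coord, Equiv.swap_apply_def]; simp only [nodeSign, hi, if_false, one_mul]
    split_ifs <;> rfl
  have hv : v i < v (prev i) := by
    rw [coroot_apply] at h; simp only [nodeSign, hi, if_false, one_mul] at h; linarith
  have hp := prev_val i
  have hi' : (i : ℕ) ≠ 0 := fun h' ↦ hi (Fin.ext h')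
  rw [if_neg hi'] at hp
  have hmem : (prev i, i) ∈ Finset.univ.filter fun x : Fin (m + 2) × Fin (m + 2) ↦ x.1 < x.2 := by
    rw [Finset.mem_filter, Fin.lt_def]; exact ⟨Finset.mem_univ _, by dsimp only; omega⟩
  unfold inversions
  rw [← Finset.add_sum_erase _ _ hmem, ← Finset.add_sum_erase _ _ hmem]
  have hs : ∀ f : ℤ → ℤ → ℕ,
      ∑ x ∈ (Finset.univ.filter fun x : Fin (m + 2) × Fin (m + 2) ↦ x.1 < x.2).erase (prev i, i),
        f (refl i v x.1) (refl i v x.2) =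
      ∑ x ∈ (Finset.univ.filter fun x : Fin (m + 2) × Fin (m + 2) ↦ x.1 < x.2).erase (prev i, i),
        f (v x.1) (v x.2) := by
    intro f
    refine Finset.sum_equiv ((Equiv.swap i (prev i)).prodCongr (Equiv.swap i (prev i))) ?_ ?_
    · rintro ⟨p, q⟩
      simp only [Finset.mem_erase, Finset.mem_filter, Finset.mem_univ, true_and, ne_eq,
        Prod.mk.injEq, Equiv.prodCongr_apply, Prod.map_apply, Equiv.swap_apply_def, Fin.ext_iff,
        Fin.lt_def]
      grind
    · rintro ⟨p, q⟩ -
      simp [hr]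
  rw [hs fun a b ↦ (if b < a then 1 else 0) + if a + b < 0 then 1 else 0]
  simp only [hr, Equiv.swap_apply_left, Equiv.swap_apply_right, hv, if_true, hv.not_gt, if_false,
    add_comm (v (prev i))]
  omega

lemma inversions_update_zero (v : Fin (m + 2) → ℤ) :
    inversions (Function.update v 0 (-v 0)) = inversions v := by
  refine Finset.sum_congr rfl ?_
  rintro ⟨p, q⟩ hpq
  have hq : q ≠ 0 := by
    rintro rfl
    simp at hpq
  by_cases hp : p = 0
  · subst hp
    simp only [Function.update_self, Function.update_of_ne hq]
    grind
  · simp only [Function.update_of_ne hq, Function.update_of_ne hp]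

lemma inversions_refl {i : Fin (m + 2)} {v : Fin (m + 2) → ℤ} (h : coroot i v < 0) :
    inversions (refl i v) + 1 = inversions v := by
  by_cases hi : i = 0
  · subst hi
    have h10 : (1 : Fin (m + 2)) ≠ 0 := by simp
    have h1 : prev (1 : Fin (m + 2)) = 0 := by simp [Fin.ext_iff, prev_val]
    have h0 : prev (0 : Fin (m + 2)) = 1 := by simp [Fin.ext_iff, prev_val]
    -- Negating coordinate 0 conjugates node 0 into node 1. It preserves `inversions` because it
    -- only swaps the two roots attached to each pair (0, q).
    have e : refl 0 v = Function.update (refl 1 (Function.update v 0 (-v 0))) 0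
        (-(refl 1 (Function.update v 0 (-v 0)) 0)) := by
      ext k
      simp only [refl_apply_coord, Function.update_apply, h0, h1, nodeSign]
      grind
    rw [e, inversions_update_zero, ← inversions_update_zero v]
    refine inversions_refl_of_ne_zero h10 ?_
    rw [coroot_apply] at h ⊢
    simp only [h0, h1, nodeSign, h10, if_false, if_true, Function.update_of_ne h10,
      Function.update_self] at h ⊢
    linarith
  · exact inversions_refl_of_ne_zero hi h

lemma inversions_rho : inversions (rho (m := m)) = 0 := by
  refine Finset.sum_eq_zero ?_
  rintro ⟨p, q⟩ h
  simp only [Finset.mem_filter, Fin.lt_def] at h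
  simp only [rho]
  grind

section Length

variable {W : Type*} [Group W] (cs : CoxeterSystem (coxeterMatrixTypeD (m + 2)) W)

theorem length_eq_inversions (w : W) : cs.length w = inversions (rep cs w rho) := by
  induction hk : cs.length w generalizing w with
  | zero =>
    rw [cs.length_eq_zero_iff] at hk
    subst hk
    simp [inversions_rho]
  | succ k ih =>
    have hw : w ≠ 1 := by rintro rfl; simp at hk
    obtain ⟨i, hi⟩ := cs.exists_leftDescent_of_ne_one hw
    have h1 := cs.isLeftDescent_iff.1 hi
    have h2 := ih (cs.simple i * w) (by omega)
    rw [isLeftDescent_iff_coroot_neg] at hi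
    rw [rep_simple_mul] at h2
    have := inversions_refl hi
    omega

/-! ### Longest elements of parabolic subgroups -/

/-- The first `p` coordinates of `v` are less than `p` in absolute value, the others at least `p`. -/
def Separated (p : ℕ) (v : Fin (m + 2) → ℤ) : Prop :=
  ∀ k : Fin (m + 2), ((k : ℕ) < p → |v k| < p) ∧ (p ≤ (k : ℕ) → (p : ℤ) ≤ v k)

lemma Separated.refl {p : ℕ} (hp : 2 ≤ p) {i : Fin (m + 2)} (hi : (i : ℕ) ≠ p)
    {v : Fin (m + 2) → ℤ} (h : Separated p v) : Separated p (refl i v) := by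
  intro k
  have hk := h k
  have h1 := h i
  have h2 := h (prev i)
  have hpv := prev_val i
  rw [refl_apply_coord]
  simp only [nodeSign, Fin.ext_iff, Fin.val_zero]
  split_ifs <;> (try simp only [neg_one_mul, one_mul, abs_neg]) <;> grind

/-- Deleting node `p ≥ 2` cuts the diagram: the remaining generators act within the coordinates
below `p`, or permute those from `p` on without sign changes. -/
lemma separated_rep {I : Finset (Fin (m + 2))} {p : Fin (m + 2)} (hp : 2 ≤ (p : ℕ)) (hpI : p ∉ I)
    {w : W} (hw : w ∈ cs.parabolic I) (v : Fin (m + 2) → ℤ) :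
    Separated p (rep cs w v) ↔ Separated p v := by
  induction hw using Subgroup.closure_induction generalizing v with
  | mem x hx =>
    obtain ⟨i, hi, rfl⟩ := hx
    have hip : (i : ℕ) ≠ p := fun h ↦ hpI (Fin.ext h ▸ hi)
    have e : rep cs (cs.simple i) v = TypeD.refl i v := by simpa using rep_simple_mul cs i 1 v
    rw [e]
    exact ⟨fun h ↦ by simpa only [refl_refl] using h.refl hp hip, fun h ↦ h.refl hp hip⟩
  | one => simp
  | mul x y _ _ hx hy => rw [map_mul, Module.End.mul_apply, hx, hy]
  | inv x _ hx => rw [← hx, ← Module.End.mul_apply, ← map_mul]; simp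

lemma separated_rho (p : ℕ) : Separated p (rho (m := m)) := by
  intro k; simp [rho]

/-- Only pairs of coordinates not separated by a missing node `r ≥ 2` can contribute, each at most
2. There are at most (x + 1) + x(x + 1)/2 such pairs for x = |I|. -/
lemma inversions_parabolic_le {I : Finset (Fin (m + 2))} {w : W} (hw : w ∈ cs.parabolic I) :
    inversions (rep cs w rho) ≤ I.card ^ 2 + 3 * I.card + 2 := by
  set v := rep cs w rho with hv
  have hsep : ∀ p q r : Fin (m + 2), p < r → r ≤ q → 2 ≤ (r : ℕ) → r ∉ I →
      v p < v q ∧ 0 ≤ v p + v q := by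
    intro p q r hpr hrq hr hrI
    have h := (separated_rep cs hr hrI hw rho).2 (separated_rho _)
    have h1 := (h p).1 hpr
    have h2 := (h q).2 hrq
    rw [← hv] at h1 h2
    rw [abs_lt] at h1
    omega
  set P : Finset (Fin (m + 2) × Fin (m + 2)) :=
    Finset.univ.filter fun x ↦ x.1 < x.2 ∧ ∀ r, x.1 < r → r ≤ x.2 → 2 ≤ (r : ℕ) → r ∈ I with hP
  have h1 : inversions v ≤ ∑ x ∈ P, 2 := by
    unfold inversions
    rw [← Finset.sum_subset (s₁ := P)]
    · refine Finset.sum_le_sum fun x _ ↦ ?_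
      split_ifs <;> simp
    · intro x hx
      simp only [hP, Finset.mem_filter, Finset.mem_univ, true_and] at hx ⊢
      exact hx.1
    · intro x hx hx'
      simp only [hP, Finset.mem_filter, Finset.mem_univ, true_and, not_and, not_forall] at hx hx'
      obtain ⟨r, h1, h2, h3, h4⟩ := hx' hx
      have := hsep x.1 x.2 r h1 h2 h3 h4
      rw [if_neg (by omega), if_neg (by omega), add_zero]
  -- A pair `(p, q)` with `p > 0` is encoded by the end nodes `p + 1 ≤ q` of its interval, both in
  -- `I`. For `p = 0`, node 1 is not required to lie in `I`, hence the extra element.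
  have h2 : P ⊆ ((insert 1 I).image fun q ↦ ((0 : Fin (m + 2)), q)) ∪
      ((I ×ˢ I).filter fun x ↦ x.1 ≤ x.2).image fun x ↦ (prev x.1, x.2) := by
    rintro ⟨p, q⟩ hx
    simp only [hP, Finset.mem_filter, Finset.mem_univ, true_and] at hx
    obtain ⟨hpq, hr⟩ := hx
    have hpq' : (p : ℕ) < q := hpq
    rw [Finset.mem_union]
    by_cases hp : p = 0
    · left
      subst hp
      rw [Finset.mem_image]
      refine ⟨q, ?_, rfl⟩
      rw [Finset.mem_insert]
      by_cases hq : q = 1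
      · exact .inl hq
      · have hq' : (q : ℕ) ≠ 1 := fun h ↦ hq (Fin.ext (by simpa using h))
        simp only [Fin.val_zero] at hpq'
        exact .inr (hr q hpq le_rfl (by omega))
    · right
      have hp' : (p : ℕ) ≠ 0 := fun h ↦ hp (Fin.ext h)
      have hr0 := q.isLt
      rw [Finset.mem_image]
      refine ⟨(⟨p + 1, by omega⟩, q), ?_, ?_⟩
      · simp only [Finset.mem_filter, Finset.mem_product, Fin.le_def]
        exact ⟨⟨hr _ (by simp [Fin.lt_def]) (by simpa [Fin.le_def] using hpq') (by simp; omega),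
          hr q hpq le_rfl (by omega)⟩, hpq'⟩
      · ext
        · simp [prev_val]
        · rfl
  have h3 : ((I ×ˢ I).filter fun x : Fin (m + 2) × Fin (m + 2) ↦ x.1 ≤ x.2).card ≤
      (I.card + 1).choose 2 := by
    rw [← Finset.card_sym2]
    refine Finset.card_le_card_of_injOn (fun x ↦ s(x.1, x.2)) ?_ ?_
    · rintro ⟨a, b⟩ h
      simp only [Finset.coe_filter, Finset.mem_product, Set.mem_ofPred_eq] at h
      simpa using h.1
    · rintro ⟨a, b⟩ h ⟨c, d⟩ h' e
      simp only [Finset.coe_filter, Finset.mem_product, Set.mem_ofPred_eq] at h h'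
      simp only [Sym2.eq_iff] at e
      rcases e with ⟨rfl, rfl⟩ | ⟨rfl, rfl⟩
      · rfl
      · rw [le_antisymm h.2 h'.2]
  have h4 : P.card ≤ (I.card + 1) + (I.card + 1).choose 2 := by
    refine (Finset.card_le_card h2).trans ((Finset.card_union_le _ _).trans ?_)
    exact add_le_add (Finset.card_image_le.trans (Finset.card_insert_le _ _))
      (Finset.card_image_le.trans h3)
  rw [Finset.sum_const, smul_eq_mul] at h1
  have h5 : (I.card + 1).choose 2 * 2 = (I.card + 1) * I.card := by
    rw [Nat.choose_two_right, Nat.add_sub_cancel]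
    exact Nat.div_mul_cancel (by simpa [mul_comm] using (Nat.even_mul_succ_self I.card).two_dvd)
  nlinarith

lemma maxw₀_le (x : ℕ) : cs.maxw₀ x ≤ x ^ 2 + 3 * x + 2 := by
  refine Finset.sup_le fun I hI ↦ ?_
  rw [Finset.mem_powersetCard] at hI
  refine csSup_le' ?_
  rintro _ ⟨w, hw, rfl⟩
  rw [← hI.2, length_eq_inversions]
  exact inversions_parabolic_le cs hw

end Length

end TypeD

/-! ### Proper elements force a large sign sum -/

namespace TypeD

/-- For i < j the pair contributes 1 if position i has the larger absolute value, and 1 - ε_j, that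
is 0 or 2, if position j has. -/
lemma inversions_signedVec {n : ℕ} (π : Equiv.Perm (Fin n)) (ε : Fin n → ℤˣ) :
    2 * (inversions (signedVec π ε) : ℤ) =
      n * (n - 1) - 2 * ∑ j, (ε j : ℤ) * smallerBefore π j := by
  have h1 : (inversions (signedVec π ε) : ℤ) =
      ∑ j, ∑ i, if i < j then (1 - (ε j : ℤ) * if π i < π j then 1 else 0) else 0 := by
    unfold inversions
    rw [Finset.sum_filter, Fintype.sum_prod_type_right]
    push_cast
    refine Finset.sum_congr rfl fun j _ ↦ Finset.sum_congr rfl fun i _ ↦ ?_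
    by_cases hij : i < j
    · have hne : (π i : ℕ) ≠ π j := fun h ↦ hij.ne (π.injective (Fin.ext h))
      have e1 : signedVec π ε i = ε i * (π i : ℕ) := rfl
      have e2 : signedVec π ε j = ε j * (π j : ℕ) := rfl
      rw [if_pos hij, if_pos hij]
      rw [e1, e2]
      simp only [Fin.lt_def]
      rcases Int.units_eq_one_or (ε i) with h | h <;>
      rcases Int.units_eq_one_or (ε j) with h' | h' <;>
      simp only [h, h', Units.val_neg, Units.val_one] <;> grind
    · rw [if_neg hij, if_neg hij]
  have h2 : ∀ j : Fin n, (∑ i, if i < j then (1 - (ε j : ℤ) * if π i < π j then 1 else 0) else 0) =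
      (j : ℕ) - (ε j : ℤ) * smallerBefore π j := by
    intro j
    rw [← Finset.sum_filter, Finset.sum_sub_distrib, ← Finset.mul_sum, smallerBefore,
      Finset.card_filter]
    have : Finset.univ.filter (fun i ↦ i < j) = Finset.Iio j := by ext; simp
    simp [this]
  have h3 : 2 * ∑ j : Fin n, ((j : ℕ) : ℤ) = n * (n - 1) := by
    rw [Fin.sum_univ_eq_sum_range (fun i ↦ (i : ℤ)) n]
    clear h1 h2 π ε
    induction n with
    | zero => simp
    | succ n ih => rw [Finset.sum_range_succ, mul_add, ih]; push_cast; ring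
  rw [h1, Finset.sum_congr rfl fun j _ ↦ h2 j, Finset.sum_sub_distrib, mul_sub, h3]

lemma exists_signedVec_eq_refl {m : ℕ} (i : Fin (m + 2)) (π : Equiv.Perm (Fin (m + 2)))
    (ε : Fin (m + 2) → ℤˣ) : ∃ π' ε', refl i (signedVec π ε) = signedVec π' ε' := by
  refine ⟨(Equiv.swap i (prev i)).trans π,
    fun k ↦ (if i = 0 ∧ (k = i ∨ k = prev i) then -1 else 1) * ε (Equiv.swap i (prev i) k), ?_⟩
  ext k
  rw [refl_apply_coord]
  simp only [signedVec, Equiv.trans_apply, Equiv.swap_apply_def, nodeSign]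
  by_cases h0 : i = 0 <;> by_cases h1 : k = i <;> by_cases h2 : k = prev i <;>
    simp [h0, h1, h2] <;> grind

variable {m : ℕ} {W : Type*} [Group W] (cs : CoxeterSystem (coxeterMatrixTypeD (m + 2)) W)

lemma exists_rep_rho_eq_signedVec (w : W) :
    ∃ x : Equiv.Perm (Fin (m + 2)) × (Fin (m + 2) → ℤˣ), rep cs w rho = signedVec x.1 x.2 := by
  induction w using cs.simple_induction_left with
  | one => exact ⟨(1, 1), by ext k; simp [signedVec, rho]⟩
  | mul_simple_left w i h =>
    obtain ⟨x, hx⟩ := h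
    obtain ⟨π', ε', h'⟩ := exists_signedVec_eq_refl i x.1 x.2
    exact ⟨(π', ε'), by rw [rep_simple_mul, hx, h']⟩

lemma leftDescentCount_le {w : W} {v : Fin (m + 2) → ℤ} (h : rep cs w rho = v) :
    cs.leftDescentCount w ≤
      (Finset.univ.filter fun j : Fin (m + 1) ↦ v j.succ < v j.castSucc).card + 1 := by
  set D := Finset.univ.filter fun j : Fin (m + 1) ↦ v j.succ < v j.castSucc with hD
  have hsub : {j | cs.IsLeftDescent w j} ⊆ ((insert 0 (D.image Fin.succ) : Finset _) : Set _) := by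
    intro i hi
    rw [Set.mem_ofPred_eq, isLeftDescent_iff_coroot_neg, h, coroot_apply] at hi
    induction i using Fin.cases with
    | zero => simp
    | succ j =>
      have e : prev j.succ = j.castSucc := Fin.ext (by rw [prev_val]; simp)
      have hne : j.succ ≠ 0 := Fin.succ_ne_zero j
      rw [e, nodeSign, if_neg hne] at hi
      rw [Finset.mem_coe, Finset.mem_insert]
      exact .inr (Finset.mem_image_of_mem _ (by simp [hD]; linarith))
  calc cs.leftDescentCount w ≤ ((insert 0 (D.image Fin.succ) : Finset _) : Set _).ncard :=
        Set.ncard_le_ncard hsub (Finset.finite_toSet _)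
    _ ≤ _ := by
        rw [Set.ncard_coe_finset]
        exact (Finset.card_insert_le _ _).trans (by grw [Finset.card_image_le])

lemma large_sum_of_isProper (hm : 1000 ≤ m + 2) {w : W} (hw : cs.IsProper w)
    {π : Equiv.Perm (Fin (m + 2))} {ε : Fin (m + 2) → ℤˣ} (h : rep cs w rho = signedVec π ε) :
    (((m + 2 : ℕ) : ℝ) ^ 2 / 10 ≤ ∑ j, ((ε j : ℤ) : ℝ) * (smallerBefore π j : ℝ)) ∨
      (((m + 2 : ℕ) : ℝ) / 5 ≤ ∑ j, ((ε j : ℤ) : ℝ) * (descentCoeff π j : ℝ)) := by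
  by_contra! hcon
  obtain ⟨c1, c2⟩ := hcon
  have h1 : cs.length w ≤ (m + 2) + (cs.leftDescentCount w ^ 2 + 3 * cs.leftDescentCount w + 2) := by
    have := hw
    rw [CoxeterSystem.IsProper, Fintype.card_fin] at this
    exact this.trans (by grw [maxw₀_le])
  have h2 := leftDescentCount_le cs h
  have h3 := sum_sign_mul_descentCoeff π ε
  have h4 := inversions_signedVec π ε
  rw [← h, ← length_eq_inversions] at h4
  have h3' : ∑ k, ((ε k : ℤ) : ℝ) * (descentCoeff π k : ℝ) =
      ((∑ k, (ε k : ℤ) * descentCoeff π k : ℤ) : ℝ) := by push_cast; rfl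
  have h4' : ∑ k, ((ε k : ℤ) : ℝ) * (smallerBefore π k : ℝ) =
      ((∑ k, (ε k : ℤ) * smallerBefore π k : ℤ) : ℝ) := by push_cast; rfl
  rw [h3', h3] at c2
  rw [h4'] at c1
  have h5 : (2 * (cs.length w : ℝ)) = ((m + 2 : ℕ) : ℝ) * (((m + 2 : ℕ) : ℝ) - 1) -
      2 * ((∑ k, (ε k : ℤ) * smallerBefore π k : ℤ) : ℝ) := by exact_mod_cast h4
  have h1' : (cs.length w : ℝ) ≤ ((m + 2 : ℕ) : ℝ) +
    ((cs.leftDescentCount w : ℝ) ^ 2 + 3 * cs.leftDescentCount w + 2) := by exact_mod_cast h1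
  have h2' : (cs.leftDescentCount w : ℝ) ≤ ((Finset.univ.filter fun j : Fin (m + 1) ↦
      signedVec π ε j.succ < signedVec π ε j.castSucc).card : ℝ) + 1 := by exact_mod_cast h2
  push_cast at c2
  have hn : (1000 : ℝ) ≤ ((m + 2 : ℕ) : ℝ) := by exact_mod_cast hm
  have hd0 : (0 : ℝ) ≤ cs.leftDescentCount w := Nat.cast_nonneg _
  obtain ⟨n, hmn⟩ : ∃ n : ℝ, n = ((m + 2 : ℕ) : ℝ) := ⟨_, rfl⟩
  have hmn' : (m : ℝ) = n - 2 := by rw [hmn]; push_cast; ring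
  rw [← hmn] at c1 h5 h1' hn
  rw [hmn'] at c2
  -- From (n - 1 + n/5)/2 + 1. Its square is about 0.36 n², while the length exceeds 0.4 n² - n/2,
  -- so properness fails for large n.
  have hd : (cs.leftDescentCount w : ℝ) ≤ 3 / 5 * n + 1 := by linarith
  have hd2 : (cs.leftDescentCount w : ℝ) ^ 2 ≤ (3 / 5 * n + 1) ^ 2 := by gcongr
  have hn2 : 1000 * n ≤ n ^ 2 := by rw [pow_two]; gcongr
  linarith only [c1, h5, h1', hd, hd2, hn2, hn]

lemma card_large_sum_le (hm : 1000 ≤ m + 2) (π : Equiv.Perm (Fin (m + 2))) :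
    ((Finset.univ.filter fun ε : Fin (m + 2) → ℤˣ ↦
      (((m + 2 : ℕ) : ℝ) ^ 2 / 10 ≤ ∑ j, ((ε j : ℤ) : ℝ) * (smallerBefore π j : ℝ)) ∨
      (((m + 2 : ℕ) : ℝ) / 5 ≤ ∑ j, ((ε j : ℤ) : ℝ) * (descentCoeff π j : ℝ))).card : ℝ) ≤
    2 ^ (m + 2) * Real.exp (-(1 / 400 * (m + 2 : ℕ))) := by
  rw [Finset.filter_or]
  have hn : (1000 : ℝ) ≤ ((m + 2 : ℕ) : ℝ) := by exact_mod_cast hm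
  -- In both applications `t` is the threshold divided by the bound on the sum of squares (n³, then
  -- n), which optimises the exponent: -n/200 and -n/50.
  have h1 := card_sum_ge_le (fun j ↦ (smallerBefore π j : ℝ)) (1 / (10 * ((m + 2 : ℕ) : ℝ)))
    (((m + 2 : ℕ) : ℝ) ^ 2 / 10) (by positivity)
  have h2 := card_sum_ge_le (fun j ↦ (descentCoeff π j : ℝ)) (1 / 5)
    (((m + 2 : ℕ) : ℝ) / 5) (by positivity)
  have s1 : ∑ j, (smallerBefore π j : ℝ) ^ 2 ≤ ((m + 2 : ℕ) : ℝ) ^ 3 := by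
    calc ∑ j, (smallerBefore π j : ℝ) ^ 2 ≤ ∑ _j : Fin (m + 2), ((m + 2 : ℕ) : ℝ) ^ 2 := by
          refine Finset.sum_le_sum fun j _ ↦ ?_
          have := smallerBefore_le π j
          gcongr
      _ = _ := by rw [Finset.sum_const, Finset.card_univ, Fintype.card_fin, nsmul_eq_mul]; ring
  have s2 : ∑ j, (descentCoeff π j : ℝ) ^ 2 ≤ ((m + 2 : ℕ) : ℝ) := by
    calc ∑ j, (descentCoeff π j : ℝ) ^ 2 ≤ ∑ _j : Fin (m + 2), (1 : ℝ) :=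
          Finset.sum_le_sum fun j _ ↦ by exact_mod_cast descentCoeff_sq_le π j
      _ = _ := by simp
  set n : ℝ := ((m + 2 : ℕ) : ℝ) with hndef
  have hn0 : 0 < n := by linarith
  have e1 : -(1 / (10 * n) * (n ^ 2 / 10)) + (1 / (10 * n)) ^ 2 / 2 *
      ∑ j, (smallerBefore π j : ℝ) ^ 2 ≤ -(n / 200) := by
    calc _ ≤ -(1 / (10 * n) * (n ^ 2 / 10)) + (1 / (10 * n)) ^ 2 / 2 * n ^ 3 := by gcongr
      _ = _ := by field_simp; ring
  have e2 : -(1 / 5 * (n / 5)) + (1 / 5 : ℝ) ^ 2 / 2 * ∑ j, (descentCoeff π j : ℝ) ^ 2 ≤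
      -(n / 200) := by linarith
  -- The factor 2 of the union bound is absorbed by giving up half of the exponent n/200.
  have h3 : (2 : ℝ) ≤ Real.exp (n / 400) := by
    have := Real.add_one_le_exp (n / 400)
    linarith
  calc _ ≤ (2 : ℝ) ^ (m + 2) * Real.exp (-(n / 200)) + 2 ^ (m + 2) * Real.exp (-(n / 200)) := by
        refine (Nat.cast_le.2 (Finset.card_union_le _ _)).trans ?_
        rw [Nat.cast_add]
        exact add_le_add (h1.trans (by gcongr)) (h2.trans (by gcongr))
    _ = 2 ^ (m + 2) * (2 * Real.exp (-(n / 200))) := by ring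
    _ ≤ 2 ^ (m + 2) * (Real.exp (n / 400) * Real.exp (-(n / 200))) := by gcongr
    _ = _ := by rw [← Real.exp_add]; congr 2; ring

theorem card_isProper_le (hm : 1000 ≤ m + 2) :
    {w : W | cs.IsProper w}.Finite ∧ ({w : W | cs.IsProper w}.ncard : ℝ) ≤
      2 ^ (m + 2) * ((m + 2).factorial : ℝ) * Real.exp (-(1 / 400 * (m + 2 : ℕ))) := by
  choose f hf using exists_rep_rho_eq_signedVec cs
  have hinj : Function.Injective f := fun w w' h ↦
    rep_rho_injective cs (by dsimp only; rw [hf, hf, h])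
  let P : Equiv.Perm (Fin (m + 2)) → (Fin (m + 2) → ℤˣ) → Prop := fun π ε ↦
    (((m + 2 : ℕ) : ℝ) ^ 2 / 10 ≤ ∑ j, ((ε j : ℤ) : ℝ) * (smallerBefore π j : ℝ)) ∨
      (((m + 2 : ℕ) : ℝ) / 5 ≤ ∑ j, ((ε j : ℤ) : ℝ) * (descentCoeff π j : ℝ))
  classical
  let F := (Finset.univ : Finset (Equiv.Perm (Fin (m + 2)))).sigma fun π ↦
    Finset.univ.filter (P π)
  refine ⟨Set.Finite.subset (Set.finite_univ.preimage hinj.injOn) (Set.subset_univ _), ?_⟩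
  have h1 : {w : W | cs.IsProper w}.ncard ≤ F.card := by
    rw [← Set.ncard_coe_finset]
    refine Set.ncard_le_ncard_of_injOn (fun w ↦ ⟨(f w).1, (f w).2⟩) ?_ ?_ (Finset.finite_toSet _)
    · intro w hw
      simp only [F, Finset.mem_coe, Finset.mem_sigma, Finset.mem_filter, Finset.mem_univ, true_and]
      exact large_sum_of_isProper cs hm hw (hf w)
    · intro w _ w' _ h
      simp only [Sigma.mk.injEq, heq_eq_eq] at h
      exact hinj (Prod.ext h.1 h.2)
  calc ({w : W | cs.IsProper w}.ncard : ℝ) ≤ F.card := Nat.cast_le.2 h1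
    _ = ∑ π : Equiv.Perm (Fin (m + 2)), ((Finset.univ.filter (P π)).card : ℝ) := by
        rw [Finset.card_sigma, Nat.cast_sum]
    _ ≤ ∑ π : Equiv.Perm (Fin (m + 2)), 2 ^ (m + 2) * Real.exp (-(1 / 400 * (m + 2 : ℕ))) := by
        refine Finset.sum_le_sum fun π _ ↦ ?_
        convert card_large_sum_le hm π
    _ = _ := by
        rw [Finset.sum_const, Finset.card_univ, Fintype.card_perm, Fintype.card_fin, nsmul_eq_mul]
        ring

end TypeD

theorem proposition5p6 :
    ∃ c : ℝ, 0 < c ∧ ∃ N : ℕ, ∀ n : ℕ, N ≤ n →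
      ∀ (W : Type*) [Group W] (cs : CoxeterSystem (coxeterMatrixTypeD n) W),
        {w : W | cs.IsProper w}.Finite ∧
        ({w : W | cs.IsProper w}.ncard : ℝ) ≤
          2 ^ n * (n.factorial : ℝ) * Real.exp (-(c * n)) := by
  refine ⟨1 / 400, by norm_num, 1000, fun n hn W _ cs ↦ ?_⟩
  obtain ⟨m, rfl⟩ : ∃ m, n = m + 2 := ⟨n - 2, by omega⟩
  exact TypeD.card_isProper_le cs hn
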